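/- All manifolds are $C^\infty$, finite-dimensional, Hausdorff, second countable, connected and without boundary. Let $M$ be such a manifold and $L\to M$ a $C^\infty$ real line bundle. Let $p\colon\tilde M_L\to M$ be its associated $2$-fold covering: $\tilde M_L$ is the set of nonzero vectors of $L$ modulo multiplication by positive scalars, with the quotient topology, so that the two points over $x\in M$ are the two orientations of the line $L_x$ (equivalently, $\tilde M_L$ is the space of unit vectors of $L$ for any fibre metric). A diffeomorphism $\varphi\colon M\to M$ is said to lift to an automorphism of $L$ if there is a $C^\infty$ diffeomorphism $\Phi\colon L\to L$ of the total space which maps each fibre $L_x$ linearly into the fibre $L_{\varphi(x)}$. (1) Let $\varphi\colon M\to M$ be a diffeomorphism, let $\tilde x\in\tilde M_L$, $x=p(\tilde x)$, and let $\gamma$ be a path in $M$ from $\varphi(x)$ to $x$. Let $\varphi_*\colon\pi_1(M,x)\to\pi_1(M,x)$ be the homomorphism $\pi_1(M,x)\to\pi_1(M,\varphi(x))$ induced by $\varphi$ followed by the change of base point $\pi_1(M,\varphi(x))\cong\pi_1(M,x)$ along $\gamma$. Then $\varphi$ lifts to an automorphism of $L$ if and only if $\varphi_*$ maps the subgroup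 $p_*\pi_1(\tilde M_L,\tilde x)$ of $\pi_1(M,x)$ onto itself, that is, $\varphi_*\bigl(p_*\pi_1(\tilde M_L,\tilde x)\bigr)=p_*\pi_1(\tilde M_L,\tilde x)$. (2) In particular, if for some $x\in M$ the group $\pi_1(M,x)$ has exactly one subgroup of index $2$, then every diffeomorphism of $M$ lifts to an automorphism of every real line bundle over $M$. -/

import Mathlib

open scoped Manifold ContDiff Bundle
open Bundle

/-- Two nonzero vectors of a real vector bundle are equivalent when they lie in the same fibre and
differ by a positive scalar. -/
def raySetoid {M : Type*} (L : M → Type*) [∀ x, AddCommGroup (L x)] [∀ x, Module ℝ (L x)] :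
    Setoid {v : TotalSpace ℝ L // v.2 ≠ 0} where
  r v w := ∃ c : ℝ, 0 < c ∧ w.1 = ⟨v.1.1, c • v.1.2⟩
  iseqv :=
    { refl := fun v => ⟨1, one_pos, by rw [one_smul]⟩
      symm := by
        rintro ⟨⟨x, v⟩, hv⟩ ⟨w, hw⟩ ⟨c, hc, h⟩
        dsimp only at h
        subst h
        refine ⟨c⁻¹, inv_pos.mpr hc, ?_⟩
        dsimp only
        rw [smul_smul, inv_mul_cancel₀ hc.ne', one_smul]
      trans := by
        rintro ⟨⟨x, v⟩, hv⟩ ⟨w, hw⟩ ⟨u, hu⟩ ⟨c, hc, h⟩ ⟨d, hd, h'⟩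
        dsimp only at h
        subst h
        dsimp only at h'
        subst h'
        refine ⟨d * c, mul_pos hd hc, ?_⟩
        dsimp only
        rw [smul_smul] }

/-- The space `M̃_L` of the 2-fold covering associated to a real line bundle `L → M`: the nonzero
vectors of `L` modulo positive scalars, with the quotient topology. Its two points over `x` are the
two orientations (half-lines) of the line `L x`; a fibre metric on `L` identifies it with
the space of unit vectors, that is, with the `O(1)`-bundle of orthonormal frames of `L`. -/
def LineCover {M : Type*} (L : M → Type*) [∀ x, AddCommGroup (L x)] [∀ x, Module ℝ (L x)] :
    Type _ :=
  Quotient (raySetoid L)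

instance LineCover.instTopologicalSpace {M : Type*} (L : M → Type*) [∀ x, AddCommGroup (L x)]
    [∀ x, Module ℝ (L x)] [TopologicalSpace (TotalSpace ℝ L)] :
    TopologicalSpace (LineCover L) :=
  inferInstanceAs (TopologicalSpace (Quotient (raySetoid L)))

/-- The covering projection `p : M̃_L → M`. -/
def LineCover.proj {M : Type*} [TopologicalSpace M] (L : M → Type*) [∀ x, AddCommGroup (L x)]
    [∀ x, Module ℝ (L x)] [TopologicalSpace (TotalSpace ℝ L)] [∀ x, TopologicalSpace (L x)]
    [FiberBundle ℝ L] : C(LineCover L, M) where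
  toFun := Quotient.lift (s := raySetoid L) (fun v => v.1.1) (by
    rintro v w ⟨c, -, h⟩
    exact (congrArg TotalSpace.proj h).symm)
  continuous_toFun := Continuous.quotient_lift
    ((FiberBundle.continuous_proj ℝ L).comp continuous_subtype_val) _

/-- The subgroup `p_* π₁(M̃_L, z)` of `π₁(M, p z)`. -/
noncomputable def LineCover.piOneSubgroup {M : Type*} [TopologicalSpace M] (L : M → Type*)
    [∀ x, AddCommGroup (L x)] [∀ x, Module ℝ (L x)] [TopologicalSpace (TotalSpace ℝ L)]
    [∀ x, TopologicalSpace (L x)] [FiberBundle ℝ L] (z : LineCover L) :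
    Subgroup (FundamentalGroup M (LineCover.proj L z)) :=
  (FundamentalGroup.map (LineCover.proj L) z).range

/-- The endomorphism `φ_*` of `π₁(M, x)`: the homomorphism `π₁(M, x) → π₁(M, φ x)` induced by `φ`,
followed by the change of base point along a path `γ` from `φ x` to `x`. -/
noncomputable def piOneMap {M : Type*} [TopologicalSpace M] (φ : C(M, M)) {x : M}
    (γ : Path (φ x) x) : FundamentalGroup M x →* FundamentalGroup M x :=
  (FundamentalGroup.fundamentalGroupMulEquivOfPath γ).toMonoidHom.comp (FundamentalGroup.map φ x)

/-- The diffeomorphism `φ` of `M` lifts to an automorphism of the line bundle `L`: there is a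
diffeomorphism `Φ` of the total space that maps each fibre `L x` linearly into `L (φ x)`. -/
def LiftsToAut {E : Type*} [NormedAddCommGroup E] [NormedSpace ℝ E] {H : Type*}
    [TopologicalSpace H] (I : ModelWithCorners ℝ E H) {M : Type*} [TopologicalSpace M]
    [ChartedSpace H M] (L : M → Type*) [∀ x, AddCommGroup (L x)] [∀ x, Module ℝ (L x)]
    [TopologicalSpace (TotalSpace ℝ L)] [∀ x, TopologicalSpace (L x)] [FiberBundle ℝ L]
    (φ : Diffeomorph I I M M ∞) : Prop :=
  ∃ Φ : Diffeomorph (I.prod 𝓘(ℝ, ℝ)) (I.prod 𝓘(ℝ, ℝ)) (TotalSpace ℝ L) (TotalSpace ℝ L) ∞,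
    ∀ x : M, ∃ A : L x →ₗ[ℝ] L (φ x), ∀ v : L x, Φ ⟨x, v⟩ = ⟨φ x, A v⟩

/-!
A path `q` from `x` to `y` in `M` lifts to the double covering `p : M̃_L → M`, and so transports the
two half-lines of `L x` to those of `L y` (`LineCover.transport`). This is available because `p` is
a covering map (`LineCover.isCoveringMap_proj`): a trivialization of `L` identifies the half-lines
over its base set with signs. Transport commutes with the exchange of the two half-lines, so a loop
at `x` fixes both half-lines of `L x` or exchanges them, and `p_* π₁(M̃_L, z)` consists of the loops
that fix them (`LineCover.mem_piOneSubgroup_iff`). In particular, it has index at most two.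

Changing the base point along `γ` does not affect whether a loop fixes half-lines. Hence `φ_*`, being
an automorphism of `π₁(M, x)`, maps the subgroup onto itself if and only if a loop `g` at `x` fixes
half-lines exactly when the loop `φ ∘ g` at `φ x` does. It remains to compare this condition with the
existence of a lift of `φ` (`liftsToAut_iff_transport`).

A lift `Φ` of `φ` is injective on the fibres, so it induces a map of `M̃_L` over `φ` that commutes
with the deck transformation; naturality of monodromy gives the condition on loops
(`transport_map_eq_self_iff_of_totalMap`). Conversely, fix a half-line `z` over `x₀` and a half-line
`w` over `φ x₀`, and call a linear map `L x → L (φ x)` positive if it sends the transport of `z`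
along `q` onto the transport of `w` along `φ ∘ q`, for every path `q` from `x₀` to `x`. By the
condition on loops, one path suffices to test this (`mem_positiveMaps_of_path`). Positive maps are
nonzero and form a convex set, and near each point multiplication by a suitable constant, in local
trivializations, is a smooth family of them (`exists_local_positiveMaps`). A partition of unity glues
these to a smooth global family (`exists_contMDiff_totalMap_of_local`), which is a diffeomorphism of
the total space because it is an isomorphism on each line (`liftsToAut_of_contMDiff_totalMap`).

If `π₁(M, x)` has a unique subgroup of index two, then `p_* π₁(M̃_L, z)` is this subgroup or the whole
group, and both are preserved by every automorphism.
-/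

/-! ### The space of half-lines of a line bundle -/

namespace LineCover

section Points

variable {M : Type*} {L : M → Type*} [∀ x, AddCommGroup (L x)] [∀ x, Module ℝ (L x)]

/-- The half-line spanned by a nonzero vector. -/
def mk {x : M} (v : L x) (hv : v ≠ 0) : LineCover L :=
  Quotient.mk (raySetoid L) ⟨⟨x, v⟩, hv⟩

theorem exists_rep (z : LineCover L) : ∃ (x : M) (v : L x) (hv : v ≠ 0), z = mk v hv := by
  obtain ⟨⟨⟨x, v⟩, hv⟩, rfl⟩ := Quotient.exists_rep z
  exact ⟨x, v, hv, rfl⟩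

theorem mk_eq_mk_iff {x : M} {v w : L x} {hv : v ≠ 0} {hw : w ≠ 0} :
    mk v hv = mk w hw ↔ ∃ c : ℝ, 0 < c ∧ w = c • v := by
  refine Quotient.eq.trans ⟨?_, ?_⟩
  · rintro ⟨c, hc, h⟩
    exact ⟨c, hc, eq_of_heq (TotalSpace.mk.inj h).2⟩
  · rintro ⟨c, hc, h⟩
    exact ⟨c, hc, congrArg (TotalSpace.mk x) h⟩

/-- The deck transformation of `LineCover L`, exchanging the two half-lines of each fibre. -/
def neg : LineCover L → LineCover L :=
  Quotient.map' (s₁ := raySetoid L) (s₂ := raySetoid L)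
    (fun v => ⟨⟨v.1.1, -v.1.2⟩, neg_ne_zero.mpr v.2⟩) (by
      rintro ⟨⟨x, v⟩, hv⟩ ⟨w, hw⟩ ⟨c, hc, h⟩
      dsimp only at h
      subst h
      exact ⟨c, hc, by simp⟩)

theorem neg_mk {x : M} (v : L x) (hv : v ≠ 0) : neg (mk v hv) = mk (-v) (neg_ne_zero.mpr hv) :=
  rfl

theorem neg_ne (z : LineCover L) : neg z ≠ z := by
  obtain ⟨x, v, hv, rfl⟩ := z.exists_rep
  rw [neg_mk, Ne, mk_eq_mk_iff]
  rintro ⟨c, hc, h⟩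
  have h' : (1 + c) • v = 0 := by
    rw [add_smul, one_smul]
    nth_rewrite 1 [h]
    simp
  rcases smul_eq_zero.mp h' with h0 | h0
  · linarith
  · exact hv h0

theorem continuous_mk_comp [TopologicalSpace (TotalSpace ℝ L)] {X : Type*}
    [TopologicalSpace X] {b : X → M} {s : ∀ t, L (b t)}
    (hs : ∀ t, s t ≠ 0) (h : Continuous fun t => (⟨b t, s t⟩ : TotalSpace ℝ L)) :
    Continuous fun t => mk (s t) (hs t) :=
  continuous_quotient_mk'.comp (h.subtype_mk _)

end Points

variable {M : Type*} [TopologicalSpace M] {L : M → Type*} [∀ x, AddCommGroup (L x)]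
  [∀ x, Module ℝ (L x)] [TopologicalSpace (TotalSpace ℝ L)] [∀ x, TopologicalSpace (L x)]
  [FiberBundle ℝ L]

theorem proj_neg (z : LineCover L) : proj L (neg z) = proj L z := by
  obtain ⟨x, v, hv, rfl⟩ := z.exists_rep
  rfl

theorem exists_rep_of_proj_eq {x : M} {z : LineCover L} (hz : proj L z = x) :
    ∃ (v : L x) (hv : v ≠ 0), z = mk v hv := by
  obtain ⟨y, v, hv, rfl⟩ := z.exists_rep
  obtain rfl : y = x := hz
  exact ⟨v, hv, rfl⟩

end LineCover

/-! ### Coordinates of a line bundle in a trivialization -/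

section Frame

variable {M : Type*} [TopologicalSpace M] {L : M → Type*} [∀ x, AddCommGroup (L x)]
  [∀ x, Module ℝ (L x)] [TopologicalSpace (TotalSpace ℝ L)]
  (e : Trivialization ℝ (TotalSpace.proj : TotalSpace ℝ L → M)) [e.IsLinear ℝ]

namespace Bundle.Trivialization

theorem snd_smul_of_mem {x : M} (hx : x ∈ e.baseSet) (c : ℝ) (v : L x) :
    (e ⟨x, c • v⟩).2 = c * (e ⟨x, v⟩).2 :=
  (e.linear ℝ hx).map_smul c v

theorem snd_ne_zero_of_mem {x : M} (hx : x ∈ e.baseSet) {v : L x} (hv : v ≠ 0) :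
    (e ⟨x, v⟩).2 ≠ 0 := by
  intro h
  apply hv
  rw [← e.symm_apply_apply_mk hx v, h]
  rw [← e.coe_symmₗ (R := ℝ) hx, map_zero]

theorem symm_ne_zero_of_mem {x : M} (hx : x ∈ e.baseSet) {a : ℝ} (ha : a ≠ 0) :
    e.symm x a ≠ 0 := by
  intro h
  apply ha
  have h1 := e.apply_mk_symm hx a
  rw [h] at h1
  exact (congrArg Prod.snd h1).symm.trans (e.linear ℝ hx).map_zero

theorem symm_mul_of_mem {x : M} (hx : x ∈ e.baseSet) (c a : ℝ) :
    e.symm x (c * a) = c • e.symm x a := by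
  rw [← e.coe_symmₗ (R := ℝ) hx, ← smul_eq_mul, map_smul]

theorem eq_smul_symm_one {x : M} (hx : x ∈ e.baseSet) (v : L x) :
    v = (e ⟨x, v⟩).2 • e.symm x 1 := by
  rw [← e.symm_mul_of_mem hx, mul_one, e.symm_apply_apply_mk hx]

end Bundle.Trivialization

end Frame

/-! ### The covering map -/

namespace LineCover

variable {M : Type*} [TopologicalSpace M] {L : M → Type*} [∀ x, AddCommGroup (L x)]
  [∀ x, Module ℝ (L x)] [TopologicalSpace (TotalSpace ℝ L)]

/-- The sign, in a trivialization `e`, of the half-lines over the base set of `e`; it is `0` on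
the half-lines over other points. -/
noncomputable def sign (e : Trivialization ℝ (TotalSpace.proj : TotalSpace ℝ L → M))
    [e.IsLinear ℝ] : LineCover L → SignType :=
  Quotient.lift (s := raySetoid L)
    (fun v => SignType.sign (e.linearMapAt ℝ v.1.1 v.1.2)) (by
      rintro ⟨⟨x, v⟩, hv⟩ ⟨w, hw⟩ ⟨c, hc, h⟩
      dsimp only at h
      subst h
      dsimp only
      rw [map_smul, smul_eq_mul, sign_mul, sign_pos hc, one_mul])

theorem sign_mk (e : Trivialization ℝ (TotalSpace.proj : TotalSpace ℝ L → M)) [e.IsLinear ℝ]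
    {x : M} (hx : x ∈ e.baseSet) (v : L x) (hv : v ≠ 0) :
    sign e (mk v hv) = SignType.sign (e ⟨x, v⟩).2 := by
  change SignType.sign (e.linearMapAt ℝ x v) = _
  rw [e.coe_linearMapAt_of_mem hx]

theorem mk_symm_of_pos (e : Trivialization ℝ (TotalSpace.proj : TotalSpace ℝ L → M)) [e.IsLinear ℝ]
    {x : M} (hx : x ∈ e.baseSet) (v : L x) (hv : v ≠ 0) {a : ℝ} (ha : a ≠ 0)
    (h : 0 < (e ⟨x, v⟩).2 * a) :
    mk (e.symm x a) (e.symm_ne_zero_of_mem hx ha) = mk v hv := by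
  rw [mk_eq_mk_iff]
  refine ⟨(e ⟨x, v⟩).2 / a, ?_, ?_⟩
  · rw [div_eq_mul_inv]
    rcases pos_and_pos_or_neg_and_neg_of_mul_pos h with h' | h'
    · exact mul_pos h'.1 (inv_pos.mpr h'.2)
    · exact mul_pos_of_neg_of_neg h'.1 (inv_lt_zero.mpr h'.2)
  · rw [← e.symm_mul_of_mem hx, div_mul_cancel₀ _ ha, e.symm_apply_apply_mk hx]

theorem continuous_mk_symm {X : Type*} [TopologicalSpace X]
    (e : Trivialization ℝ (TotalSpace.proj : TotalSpace ℝ L → M)) [e.IsLinear ℝ]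
    {b : X → M} {a : X → ℝ} (hb : Continuous b) (ha : Continuous a) (hbe : ∀ t, b t ∈ e.baseSet)
    (ha0 : ∀ t, a t ≠ 0) :
    Continuous fun t => mk (e.symm (b t) (a t)) (e.symm_ne_zero_of_mem (hbe t) (ha0 t)) :=
  continuous_mk_comp (fun t => e.symm_ne_zero_of_mem (hbe t) (ha0 t))
    (e.continuousOn_symm.comp_continuous (hb.prodMk ha) fun t => ⟨hbe t, trivial⟩)

variable [∀ x, TopologicalSpace (L x)] [FiberBundle ℝ L]

theorem continuousOn_sign (e : Trivialization ℝ (TotalSpace.proj : TotalSpace ℝ L → M))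
    [e.IsLinear ℝ] : ContinuousOn (sign e) (proj L ⁻¹' e.baseSet) := by
  have hq : Topology.IsQuotientMap (Quotient.mk (raySetoid L)) := isQuotientMap_quotient_mk'
  refine (hq.continuousOn_isOpen_iff (e.open_baseSet.preimage (proj L).continuous)).mpr ?_
  rintro ⟨⟨x, v⟩, hv⟩ (hx : x ∈ e.baseSet)
  refine ContinuousAt.continuousWithinAt ?_
  have hev : (fun w : {w : TotalSpace ℝ L // w.2 ≠ 0} => SignType.sign (e w.1).2) =ᶠ[nhds
      ⟨⟨x, v⟩, hv⟩] sign e ∘ Quotient.mk (raySetoid L) := by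
    filter_upwards [(e.open_baseSet.preimage ((FiberBundle.continuous_proj ℝ L).comp
      continuous_subtype_val)).mem_nhds (x := ⟨⟨x, v⟩, hv⟩) hx] with w hw
    exact (sign_mk e hw w.1.2 w.2).symm
  refine ContinuousAt.congr ?_ hev
  refine (continuousAt_sign_of_ne_zero (e.snd_ne_zero_of_mem hx hv)).comp (f :=
    fun w : {w : TotalSpace ℝ L // w.2 ≠ 0} => (e w.1).2) ?_
  exact continuous_snd.continuousAt.comp
    ((e.continuousAt (e.mem_source.mpr hx)).comp continuous_subtype_val.continuousAt)

variable [VectorBundle ℝ ℝ L]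

/-- Over the base set of a trivialization `e` of `L`, the space `LineCover L` is the product of
that set with the two signs. -/
noncomputable def homeomorphSign (e : Trivialization ℝ (TotalSpace.proj : TotalSpace ℝ L → M))
    [e.IsLinear ℝ] : (proj L ⁻¹' e.baseSet) ≃ₜ e.baseSet × Bool where
  toFun z := (⟨proj L z.1, z.2⟩, decide (sign e z.1 = 1))
  invFun y := ⟨mk (e.symm y.1 (if y.2 then 1 else -1))
    (e.symm_ne_zero_of_mem y.1.2 (by split_ifs <;> norm_num)), y.1.2⟩
  left_inv := by
    rintro ⟨z, hz⟩
    obtain ⟨x, v, hv, rfl⟩ := z.exists_rep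
    have hx : x ∈ e.baseSet := hz
    have ha (b : Bool) : (if b then (1 : ℝ) else -1) ≠ 0 := by split_ifs <;> norm_num
    refine Subtype.ext (mk_symm_of_pos e hx v hv (ha (decide (sign e (mk v hv) = 1))) ?_)
    rw [sign_mk e hx]
    rcases (e.snd_ne_zero_of_mem hx hv).lt_or_gt with h | h
    · simp [sign_neg h, h]
    · simp [sign_pos h, h]
  right_inv := by
    rintro ⟨⟨x, hx⟩, b⟩
    refine Prod.ext rfl ?_
    dsimp only
    rw [sign_mk e hx, e.apply_mk_symm hx]
    cases b <;> simp
  continuous_toFun := by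
    refine Continuous.prodMk (((proj L).continuous.comp continuous_subtype_val).subtype_mk _) ?_
    exact (continuous_of_discreteTopology (f := fun s : SignType => decide (s = 1))).comp
      (continuousOn_iff_continuous_domRestrict.mp (continuousOn_sign e))
  continuous_invFun := by
    refine Continuous.subtype_mk ?_ _
    have ha (b : Bool) : (if b then (1 : ℝ) else -1) ≠ 0 := by split_ifs <;> norm_num
    exact continuous_mk_symm e (continuous_subtype_val.comp continuous_fst)
      ((continuous_of_discreteTopology (f := fun b : Bool => if b then (1 : ℝ) else -1)).comp
        continuous_snd) (fun y => y.1.2) fun y => ha y.2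

variable (L) in
theorem isCoveringMap_proj : IsCoveringMap (proj L) := fun x =>
  IsEvenlyCovered.to_isEvenlyCovered_preimage (I := Bool)
    ⟨inferInstance, (trivializationAt ℝ L x).baseSet, mem_baseSet_trivializationAt ℝ L x,
      (trivializationAt ℝ L x).open_baseSet,
      (trivializationAt ℝ L x).open_baseSet.preimage (proj L).continuous,
      homeomorphSign (trivializationAt ℝ L x), fun _ => rfl⟩

theorem continuous_neg : Continuous (neg : LineCover L → LineCover L) := by
  have h1 : Continuous (fun v : TotalSpace ℝ L => (⟨v.1, -v.2⟩ : TotalSpace ℝ L)) := by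
    rw [continuous_iff_continuousAt]
    intro v
    rw [FiberBundle.continuousAt_totalSpace]
    refine ⟨(FiberBundle.continuous_proj ℝ L).continuousAt, ?_⟩
    set e := trivializationAt ℝ L v.1
    have hv : v.1 ∈ e.baseSet := mem_baseSet_trivializationAt ℝ L v.1
    have : (fun w : TotalSpace ℝ L => -(e w).2) =ᶠ[nhds v]
        fun w => (e (⟨w.1, -w.2⟩ : TotalSpace ℝ L)).2 := by
      filter_upwards [(e.open_baseSet.preimage (FiberBundle.continuous_proj ℝ L)).mem_nhds hv]
        with w hw
      exact ((e.linear ℝ hw).map_neg w.2).symm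
    refine ContinuousAt.congr ?_ this
    exact (continuous_snd.continuousAt.comp (e.continuousAt (e.mem_source.mpr hv))).neg
  exact Continuous.quotient_map' ((h1.comp continuous_subtype_val).subtype_mk _) _

theorem surjective_proj : Function.Surjective (proj L) := fun x =>
  ⟨mk ((trivializationAt ℝ L x).symm x 1) ((trivializationAt ℝ L x).symm_ne_zero_of_mem
    (mem_baseSet_trivializationAt ℝ L x) one_ne_zero), rfl⟩

end LineCover

/-! ### Transport of half-lines along paths -/

/-- Monodromy is natural for maps between covering spaces. -/
theorem IsCoveringMap.monodromy_map_of_comm {E E' X X' : Type*} [TopologicalSpace E]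
    [TopologicalSpace E'] [TopologicalSpace X] [TopologicalSpace X'] {p : E → X} {p' : E' → X'}
    (cov : IsCoveringMap p) (cov' : IsCoveringMap p') (F : C(E, E')) (f : C(X, X'))
    (h : ∀ e, p' (F e) = f (p e)) {x y : X} (γ : Path.Homotopic.Quotient x y) (e : p ⁻¹' {x}) :
    cov'.monodromy (γ.map f) ⟨F e, (h e).trans (congrArg f e.2)⟩ =
      ⟨F (cov.monodromy γ e), (h _).trans (congrArg f (cov.monodromy γ e).2)⟩ := by
  obtain ⟨γ⟩ := γ
  have h0 : γ 0 = p e := γ.source.trans e.2.symm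
  have h0' : (γ.map f.continuous) 0 = p' (F e) := by rw [h, ← h0]; rfl
  have key : F.comp (cov.liftPath γ e h0) = cov'.liftPath (γ.map f.continuous) (F e) h0' := by
    rw [cov'.eq_liftPath_iff']
    refine ⟨funext fun t => (h _).trans ?_, congrArg F (cov.liftPath_zero _ _ _)⟩
    exact congrArg f (congrFun (cov.liftPath_lifts γ e h0) t)
  exact Subtype.ext (DFunLike.congr_fun key 1).symm

namespace LineCover

variable {M : Type*} [TopologicalSpace M] {L : M → Type*} [∀ x, AddCommGroup (L x)]
  [∀ x, Module ℝ (L x)] [TopologicalSpace (TotalSpace ℝ L)] [∀ x, TopologicalSpace (L x)]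
  [FiberBundle ℝ L]

/-- The deck transformation of `LineCover L`, restricted to one fibre. -/
def fiberNeg {x : M} (z : proj L ⁻¹' {x}) : proj L ⁻¹' {x} :=
  ⟨neg z.1, (proj_neg z.1).trans z.2⟩

theorem fiberNeg_ne {x : M} (z : proj L ⁻¹' {x}) : fiberNeg z ≠ z := fun h =>
  neg_ne z.1 (congrArg Subtype.val h)

/-- The point of the fibre of `LineCover L` over `x` given by a nonzero vector of `L x`. -/
def fiberMk {x : M} (v : L x) (hv : v ≠ 0) : proj L ⁻¹' {x} := ⟨mk v hv, rfl⟩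

theorem exists_eq_fiberMk {x : M} (z : proj L ⁻¹' {x}) :
    ∃ (v : L x) (hv : v ≠ 0), z = fiberMk v hv := by
  obtain ⟨v, hv, h⟩ := exists_rep_of_proj_eq z.2
  exact ⟨v, hv, Subtype.ext h⟩

theorem fiberMk_eq_iff {x : M} {v w : L x} {hv : v ≠ 0} {hw : w ≠ 0} :
    (fiberMk v hv : proj L ⁻¹' {x}) = fiberMk w hw ↔ ∃ c : ℝ, 0 < c ∧ w = c • v :=
  Subtype.ext_iff.trans mk_eq_mk_iff

theorem fiberNeg_fiberMk {x : M} (v : L x) (hv : v ≠ 0) :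
    (fiberNeg (fiberMk v hv) : proj L ⁻¹' {x}) = fiberMk (-v) (neg_ne_zero.mpr hv) := rfl

theorem fiberNeg_fiberNeg {x : M} (z : proj L ⁻¹' {x}) : fiberNeg (fiberNeg z) = z := by
  obtain ⟨v, hv, rfl⟩ := exists_eq_fiberMk z
  simp only [fiberNeg_fiberMk, neg_neg]

variable [VectorBundle ℝ ℝ L]

theorem eq_or_eq_fiberNeg {x : M} (z z' : proj L ⁻¹' {x}) : z' = z ∨ z' = fiberNeg z := by
  obtain ⟨v, hv, rfl⟩ := exists_eq_fiberMk z
  obtain ⟨w, hw, rfl⟩ := exists_eq_fiberMk z'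
  have hx := mem_baseSet_trivializationAt ℝ L x
  set e := trivializationAt ℝ L x
  have hv' := e.snd_ne_zero_of_mem hx hv
  have hw' := e.snd_ne_zero_of_mem hx hw
  have hwv : v = ((e ⟨x, v⟩).2 / (e ⟨x, w⟩).2) • w := by
    refine (e.eq_smul_symm_one hx v).trans (Eq.trans ?_
      (congrArg (((e ⟨x, v⟩).2 / (e ⟨x, w⟩).2) • ·) (e.eq_smul_symm_one hx w)).symm)
    rw [smul_smul, div_mul_cancel₀ _ hw']
  rcases (div_ne_zero hv' hw').lt_or_gt with h | h
  · right
    rw [fiberNeg_fiberMk, fiberMk_eq_iff]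
    refine ⟨_, neg_pos.mpr h, ?_⟩
    rw [neg_smul, ← hwv]
  · left
    rw [fiberMk_eq_iff]
    exact ⟨_, h, hwv⟩

theorem fiberNeg_eq_iff_ne {x : M} {z z' : proj L ⁻¹' {x}} : fiberNeg z = z' ↔ z' ≠ z := by
  constructor
  · rintro rfl
    exact fiberNeg_ne z
  · intro h
    exact ((eq_or_eq_fiberNeg z z').resolve_left h).symm

/-- Transport of half-lines of `L` along a homotopy class of paths. -/
noncomputable abbrev transport {x y : M} (q : Path.Homotopic.Quotient x y) :
    proj L ⁻¹' {x} → proj L ⁻¹' {y} :=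
  (isCoveringMap_proj L).monodromy q

theorem transport_trans {x y w : M} (q : Path.Homotopic.Quotient x y)
    (r : Path.Homotopic.Quotient y w) (z : proj L ⁻¹' {x}) :
    transport (q.trans r) z = transport r (transport q z) :=
  (isCoveringMap_proj L).monodromy_trans_apply q r z

theorem transport_injective {x y : M} (q : Path.Homotopic.Quotient x y) :
    Function.Injective (transport (L := L) q) :=
  ((isCoveringMap_proj L).monodromy_bijective q).1

theorem transport_symm_transport {x y : M} (q : Path.Homotopic.Quotient x y)
    (z : proj L ⁻¹' {x}) : transport q.symm (transport q z) = z := by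
  rw [← transport_trans, Path.Homotopic.Quotient.trans_symm]
  exact congrFun (isCoveringMap_proj L).monodromy_refl z

theorem transport_transport_symm {x y : M} (q : Path.Homotopic.Quotient x y)
    (z : proj L ⁻¹' {y}) : transport q (transport q.symm z) = z := by
  rw [← transport_trans, Path.Homotopic.Quotient.symm_trans]
  exact congrFun (isCoveringMap_proj L).monodromy_refl z

theorem transport_fiberNeg {x y : M} (q : Path.Homotopic.Quotient x y) (z : proj L ⁻¹' {x}) :
    transport q (fiberNeg z) = fiberNeg (transport q z) := by
  have h := (isCoveringMap_proj L).monodromy_map_of_comm (isCoveringMap_proj L)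
    ⟨neg, continuous_neg⟩ (ContinuousMap.id M) proj_neg q z
  have hq : q.map (ContinuousMap.id M) = q := by
    obtain ⟨q⟩ := q
    rfl
  rw [hq] at h
  exact h

/-- A loop fixing one half-line by transport fixes both. -/
theorem transport_eq_self_iff {x : M} (q : Path.Homotopic.Quotient x x) (z z' : proj L ⁻¹' {x}) :
    transport q z = z ↔ transport q z' = z' := by
  rcases eq_or_eq_fiberNeg z z' with rfl | rfl
  · rfl
  · rw [transport_fiberNeg]
    constructor
    · intro h
      rw [h]
    · intro h
      rw [← fiberNeg_fiberNeg (transport q z), h, fiberNeg_fiberNeg]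

/-- Along a path inside the base set of a trivialization, transport keeps the sign of the
coordinate. -/
theorem transport_mk_symm (e : Trivialization ℝ (TotalSpace.proj : TotalSpace ℝ L → M))
    [e.IsLinear ℝ] {x y : M} (δ : Path x y) (hδ : ∀ t, δ t ∈ e.baseSet) (hx : x ∈ e.baseSet)
    (hy : y ∈ e.baseSet) {a : ℝ} (ha : a ≠ 0) :
    transport (.mk δ) (fiberMk (e.symm x a) (e.symm_ne_zero_of_mem hx ha)) =
      (fiberMk (e.symm y a) (e.symm_ne_zero_of_mem hy ha) : proj L ⁻¹' {y}) := by
  let Γ : C(unitInterval, LineCover L) :=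
    ⟨fun t => mk (e.symm (δ t) a) (e.symm_ne_zero_of_mem (hδ t) ha),
      continuous_mk_symm e δ.continuous continuous_const hδ fun _ => ha⟩
  have aux {b b' : M} (h : b = b') (hb : b ∈ e.baseSet) (hb' : b' ∈ e.baseSet) :
      mk (e.symm b a) (e.symm_ne_zero_of_mem hb ha) =
        mk (e.symm b' a) (e.symm_ne_zero_of_mem hb' ha) := by
    subst h
    rfl
  have h0 : Γ 0 = mk (e.symm x a) (e.symm_ne_zero_of_mem hx ha) := aux δ.source (hδ 0) hx
  have h1 : Γ 1 = mk (e.symm y a) (e.symm_ne_zero_of_mem hy ha) := aux δ.target (hδ 1) hy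
  refine Subtype.ext (Eq.trans ?_ h1)
  have hΓ := ((isCoveringMap_proj L).eq_liftPath_iff' (γ := δ)
    (e := mk (e.symm x a) (e.symm_ne_zero_of_mem hx ha)) δ.source (Γ := Γ)).mpr ⟨rfl, h0⟩
  exact (DFunLike.congr_fun hΓ 1).symm

/-! ### The subgroup of loops preserving the half-lines -/

/-- The lift of a loop starting at `z` is closed exactly when the loop comes from `M̃_L`. -/
theorem mem_piOneSubgroup_iff (z : LineCover L) (g : FundamentalGroup M (proj L z)) :
    g ∈ piOneSubgroup L z ↔
      transport (L := L) (x := proj L z) (y := proj L z) g ⟨z, rfl⟩ = ⟨z, rfl⟩ := by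
  constructor
  · rintro ⟨a, rfl⟩
    exact (isCoveringMap_proj L).monodromy_map a
  · intro h
    refine ⟨((isCoveringMap_proj L).liftPathQuotient g ⟨z, rfl⟩).cast rfl
      (congrArg Subtype.val h).symm, ?_⟩
    rw [FundamentalGroup.map_apply, Path.Homotopic.Quotient.map_cast]
    erw [(isCoveringMap_proj L).map_liftPathQuotient]
    exact (Path.Homotopic.Quotient.cast_cast ..).trans (Path.Homotopic.Quotient.cast_rfl_rfl _)

/-- Whether `φ_* g` lies in the subgroup can be tested over `φ x`: conjugation by `γ` only moves the
half-line whose stabilizer is considered, and a loop fixes one half-line if it fixes the other. -/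
theorem piOneMap_mem_piOneSubgroup_iff (φ : C(M, M)) (z : LineCover L)
    (γ : Path (φ (proj L z)) (proj L z)) (g : FundamentalGroup M (proj L z))
    (w : proj L ⁻¹' {φ (proj L z)}) :
    piOneMap φ γ g ∈ piOneSubgroup L z ↔
      transport (Path.Homotopic.Quotient.map (x₀ := proj L z) (x₁ := proj L z) g φ) w = w := by
  have hg : piOneMap φ γ g = Path.Homotopic.Quotient.trans (.symm (.mk γ))
      ((Path.Homotopic.Quotient.map (x₀ := proj L z) (x₁ := proj L z) g φ).trans (.mk γ)) := rfl
  rw [mem_piOneSubgroup_iff, hg, transport_trans, transport_trans]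
  rw [transport_eq_self_iff _ w (transport (.symm (.mk γ)) ⟨z, rfl⟩)]
  conv_lhs => rhs; rw [← transport_transport_symm (.mk γ) ⟨z, rfl⟩]
  exact (transport_injective _).eq_iff

/-- The subgroup `p_* π₁(M̃_L, z)` is the whole group or has index two. -/
theorem piOneSubgroup_eq_top_or_index_eq_two (z : LineCover L) :
    piOneSubgroup L z = ⊤ ∨ (piOneSubgroup L z).index = 2 := by
  by_cases h : ∀ g, g ∈ piOneSubgroup L z
  · exact Or.inl ((Subgroup.eq_top_iff' _).mpr h)
  · push Not at h
    obtain ⟨a, ha⟩ := h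
    right
    rw [Subgroup.index_eq_two_iff]
    refine ⟨a, fun b => ?_⟩
    rw [mem_piOneSubgroup_iff] at ha
    have hba : b * a = Path.Homotopic.Quotient.trans (x₀ := proj L z) (x₁ := proj L z) a b := rfl
    rw [mem_piOneSubgroup_iff, mem_piOneSubgroup_iff, hba, transport_trans,
      ← fiberNeg_eq_iff_ne.mpr ha, transport_fiberNeg, fiberNeg_eq_iff_ne]
    tauto

end LineCover

/-- A homeomorphism acts bijectively on the fundamental group. -/
theorem piOneMap_bijective {M : Type*} [TopologicalSpace M] (φ : M ≃ₜ M) {x : M}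
    (γ : Path (φ x) x) : Function.Bijective (piOneMap (φ : C(M, M)) γ) := by
  refine (FundamentalGroup.fundamentalGroupMulEquivOfPath γ).bijective.comp ?_
  let ε := FundamentalGroupoidFunctor.equivOfHomotopyEquiv φ.toHomotopyEquiv
  exact ⟨ε.functor.map_injective, ε.functor.map_surjective⟩

/-! ### Manifolds without boundary are locally path connected -/

section Manifold

variable {E : Type*} [NormedAddCommGroup E] [NormedSpace ℝ E] {H : Type*} [TopologicalSpace H]
  (I : ModelWithCorners ℝ E H) {M : Type*} [TopologicalSpace M] [ChartedSpace H M]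

variable (M) in
/-- A manifold without boundary is locally path connected: near an interior point, the extended
charts identify it with an open set of the model vector space. -/
theorem BoundarylessManifold.locallyPathConnectedSpace [BoundarylessManifold I M] :
    LocallyPathConnectedSpace M := by
  refine ⟨fun x => Filter.hasBasis_self.mpr fun n hn => ?_⟩
  have hx : I.IsInteriorPoint x := BoundarylessManifold.isInteriorPoint
  have ht : (extChartAt I x).target ∈ nhds (extChartAt I x x) :=
    mem_interior_iff_mem_nhds.mp (ModelWithCorners.isInteriorPoint_iff.mp hx)
  have hs : (extChartAt I x).symm ⁻¹' n ∈ nhds (extChartAt I x x) :=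
    continuousAt_extChartAt_symm x (by rwa [extChartAt_to_inv])
  obtain ⟨r, hr, hrs⟩ := Metric.mem_nhds_iff.mp (Filter.inter_mem ht hs)
  refine ⟨(extChartAt I x).symm '' Metric.ball (extChartAt I x x) r, ?_, ?_, ?_⟩
  · filter_upwards [extChartAt_source_mem_nhds (I := I) x,
      (continuousAt_extChartAt (I := I) x) (Metric.ball_mem_nhds _ hr)] with y hy hy'
    exact ⟨_, hy', (extChartAt I x).left_inv hy⟩
  · refine ((convex_ball _ r).isPathConnected (Metric.nonempty_ball.mpr hr)).image' ?_
    exact (continuousOn_extChartAt_symm x).mono fun y hy => (hrs hy).1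
  · rintro _ ⟨y, hy, rfl⟩
    exact (hrs hy).2

/-! ### Smooth maps of line bundles that are linear on the fibres -/

variable {I}
variable {L : M → Type*} [∀ x, AddCommGroup (L x)] [∀ x, Module ℝ (L x)]
    [TopologicalSpace (TotalSpace ℝ L)] [∀ x, TopologicalSpace (L x)] [FiberBundle ℝ L]

/-- The map of total spaces given by a family of linear maps of fibres over `φ : M → M`. -/
def totalMap (φ : M → M) (A : ∀ x, L x →ₗ[ℝ] L (φ x)) : TotalSpace ℝ L → TotalSpace ℝ L :=
  fun v => ⟨φ v.1, A v.1 v.2⟩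

variable [VectorBundle ℝ ℝ L]

open LineCover in
/-- A map of total spaces that is linear on the fibres and injective induces a map of the covering
spaces, so a loop preserves the half-lines of `L` if and only if its image does. -/
theorem transport_map_eq_self_iff_of_totalMap {φ : C(M, M)} {A : ∀ x, L x →ₗ[ℝ] L (φ x)}
    (hA : ∀ x, Function.Injective (A x)) (hc : Continuous (totalMap φ A)) {x : M}
    (q : Path.Homotopic.Quotient x x) (z : proj L ⁻¹' {x}) (w : proj L ⁻¹' {φ x}) :
    transport q z = z ↔ transport (q.map φ) w = w := by
  have hA0 {y : M} {v : L y} (hv : v ≠ 0) : A y v ≠ 0 := (map_ne_zero_iff _ (hA y)).mpr hv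
  let F : C(LineCover L, LineCover L) :=
    ⟨Quotient.map' (s₁ := raySetoid L) (s₂ := raySetoid L)
      (fun v => ⟨totalMap φ A v.1, hA0 v.2⟩) (by
        rintro ⟨⟨x, v⟩, hv⟩ ⟨w, hw⟩ ⟨c, hc, h⟩
        dsimp only at h
        subst h
        exact ⟨c, hc, congrArg (TotalSpace.mk (φ x)) ((A x).map_smul c v)⟩),
      Continuous.quotient_map' ((hc.comp continuous_subtype_val).subtype_mk _) _⟩
  have hF {y : M} (v : L y) (hv : v ≠ 0) : F (mk v hv) = mk (A y v) (hA0 hv) := rfl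
  have hproj (u : LineCover L) : proj L (F u) = φ (proj L u) := by
    obtain ⟨y, v, hv, rfl⟩ := u.exists_rep
    rfl
  have hneg (u : LineCover L) : F (neg u) = neg (F u) := by
    obtain ⟨y, v, hv, rfl⟩ := u.exists_rep
    rw [neg_mk, hF, hF, neg_mk]
    simp only [map_neg]
  have hnat : (transport (q.map φ) ⟨F z, (hproj z).trans (congrArg φ z.2)⟩ :
      proj L ⁻¹' {φ x}).1 = F (transport q z).1 :=
    congrArg Subtype.val
      ((isCoveringMap_proj L).monodromy_map_of_comm (isCoveringMap_proj L) F φ hproj q z)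
  rw [← transport_eq_self_iff _ ⟨F z, (hproj z).trans (congrArg φ z.2)⟩ w, Subtype.ext_iff,
    Subtype.ext_iff, hnat]
  constructor
  · intro h
    rw [h]
  · intro h
    rcases eq_or_eq_fiberNeg z (transport q z) with h' | h'
    · exact congrArg Subtype.val h'
    · rw [h'] at h
      exact (neg_ne _ ((hneg _).symm.trans h)).elim

variable [ContMDiffVectorBundle ∞ ℝ L I]

theorem contMDiffAt_totalMap_iff {φ : M → M} {A : ∀ x, L x →ₗ[ℝ] L (φ x)}
    (hφ : ContMDiff I I ∞ φ) (e : Trivialization ℝ (TotalSpace.proj : TotalSpace ℝ L → M))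
    [MemTrivializationAtlas e] {v : TotalSpace ℝ L} (hv : φ v.1 ∈ e.baseSet) :
    ContMDiffAt (I.prod 𝓘(ℝ, ℝ)) (I.prod 𝓘(ℝ, ℝ)) ∞ (totalMap φ A) v ↔
      ContMDiffAt (I.prod 𝓘(ℝ, ℝ)) 𝓘(ℝ, ℝ) ∞
        (fun w : TotalSpace ℝ L => (e (totalMap φ A w)).2) v := by
  rw [e.contMDiffAt_iff (e.mem_source.mpr hv)]
  exact and_iff_right (hφ.contMDiffAt.comp v (contMDiffAt_proj L))

theorem contMDiffAt_trivialization_snd (e : Trivialization ℝ (TotalSpace.proj : TotalSpace ℝ L → M))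
    [MemTrivializationAtlas e] {v : TotalSpace ℝ L} (hv : v.1 ∈ e.baseSet) :
    ContMDiffAt (I.prod 𝓘(ℝ, ℝ)) 𝓘(ℝ, ℝ) ∞ (fun w : TotalSpace ℝ L => (e w).2) v :=
  ((e.contMDiffAt_iff (IB := I) (e.mem_source.mpr hv)).mp contMDiffAt_id).2

/-- Fibrewise convex conditions on smooth maps of line bundles over `φ` can be met globally as soon
as they can be met locally: smooth local solutions are glued by a partition of unity. -/
theorem exists_contMDiff_totalMap_of_local [FiniteDimensional ℝ E] [IsManifold I ∞ M]
    [T2Space M] [SigmaCompactSpace M] {φ : M → M} (hφ : ContMDiff I I ∞ φ)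
    (t : ∀ x, Set (L x →ₗ[ℝ] L (φ x))) (ht : ∀ x, Convex ℝ (t x))
    (hloc : ∀ x₀, ∃ U ∈ nhds x₀, ∃ A : ∀ x, L x →ₗ[ℝ] L (φ x), ∀ x ∈ U, A x ∈ t x ∧
      ∀ v : L x, ContMDiffAt (I.prod 𝓘(ℝ, ℝ)) (I.prod 𝓘(ℝ, ℝ)) ∞ (totalMap φ A) ⟨x, v⟩) :
    ∃ A : ∀ x, L x →ₗ[ℝ] L (φ x), (∀ x, A x ∈ t x) ∧
      ContMDiff (I.prod 𝓘(ℝ, ℝ)) (I.prod 𝓘(ℝ, ℝ)) ∞ (totalMap φ A) := by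
  choose U hU B hB using hloc
  obtain ⟨ρ, hρ⟩ := SmoothPartitionOfUnity.exists_isSubordinate I isClosed_univ
    (fun x => interior (U x)) (fun x => isOpen_interior)
    (fun x _ => Set.mem_iUnion.mpr ⟨x, mem_interior_iff_mem_nhds.mpr (hU x)⟩)
  have hfin (x : M) : (Function.support fun i => ρ i x).Finite := ρ.locallyFinite.point_finite x
  refine ⟨fun x => ∑ᶠ i, ρ i x • B i x, fun x => ?_, ?_⟩
  · refine (ht x).finsum_mem (fun i => ρ.nonneg i x) (ρ.sum_eq_one (Set.mem_univ x)) fun i hi => ?_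
    exact (hB i x (interior_subset (hρ i (subset_closure hi)))).1
  · intro v
    set e := trivializationAt ℝ L (φ v.1) with he
    have hv : φ v.1 ∈ e.baseSet := mem_baseSet_trivializationAt ℝ L (φ v.1)
    rw [contMDiffAt_totalMap_iff hφ e hv]
    have hsum : ContMDiffAt (I.prod 𝓘(ℝ, ℝ)) 𝓘(ℝ, ℝ) ∞ (fun w : TotalSpace ℝ L =>
        ∑ᶠ i, ρ i w.1 • (e (totalMap φ (B i) w)).2) v := by
      refine contMDiffAt_finsum ?_ fun i => ?_
      · refine (ρ.locallyFinite.preimage_continuous (FiberBundle.continuous_proj ℝ L)).subset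
          fun i w hw => ?_
        exact left_ne_zero_of_smul hw
      · by_cases hi : v.1 ∈ tsupport (ρ i)
        · refine ContMDiffAt.smul (f := fun w : TotalSpace ℝ L => ρ i w.1)
            ((ρ i).contMDiff.contMDiffAt.comp v (contMDiffAt_proj L)) ?_
          exact (contMDiffAt_totalMap_iff hφ e hv).mp
            ((hB i v.1 (interior_subset (hρ i hi))).2 v.2)
        · refine (contMDiffAt_const (c := (0 : ℝ))).congr_of_eventuallyEq ?_
          filter_upwards [(FiberBundle.continuous_proj ℝ L).continuousAt.preimage_mem_nhds
            ((isClosed_tsupport (ρ i)).isOpen_compl.mem_nhds hi)] with w hw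
          rw [image_eq_zero_of_notMem_tsupport hw, zero_smul]
    refine hsum.congr_of_eventuallyEq ?_
    filter_upwards [((hφ.continuous.comp (FiberBundle.continuous_proj ℝ L)).continuousAt
      (x := v)).preimage_mem_nhds (e.open_baseSet.mem_nhds hv)] with w hw
    have hw' : φ w.1 ∈ e.baseSet := hw
    have h1 : (∑ᶠ i, ρ i w.1 • B i w.1) w.2 = ∑ᶠ i, ρ i w.1 • B i w.1 w.2 := by
      have := (LinearMap.applyₗ (R := ℝ) (M₂ := L (φ w.1)) w.2).toAddMonoidHom.map_finsum
        (f := fun i => ρ i w.1 • B i w.1)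
        ((hfin w.1).subset fun i hi => left_ne_zero_of_smul hi)
      exact this
    change (e ⟨φ w.1, (∑ᶠ i, ρ i w.1 • B i w.1) w.2⟩).2 = _
    rw [h1]
    have h2 := (e.linearMapAt ℝ (φ w.1)).toAddMonoidHom.map_finsum
      (f := fun i => ρ i w.1 • B i w.1 w.2)
      ((hfin w.1).subset fun i hi => left_ne_zero_of_smul hi)
    simp only [LinearMap.toAddMonoidHom_coe, e.coe_linearMapAt_of_mem hw',
      e.snd_smul_of_mem hw'] at h2
    exact h2

/-- A smooth map of line bundles over a diffeomorphism that is injective on the fibres is a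
diffeomorphism of total spaces: in trivializations, its inverse is multiplication by the
reciprocal of a smooth function without zeros. -/
theorem liftsToAut_of_contMDiff_totalMap {φ : Diffeomorph I I M M ∞}
    {A : ∀ x, L x →ₗ[ℝ] L (φ x)} (hA : ∀ x, Function.Injective (A x))
    (hs : ContMDiff (I.prod 𝓘(ℝ, ℝ)) (I.prod 𝓘(ℝ, ℝ)) ∞ (totalMap φ A)) :
    LiftsToAut I L φ := by
  -- The coefficient of `A` in two trivializations.
  have hcoef {x : M} {v : L x} (e e' : Trivialization ℝ (TotalSpace.proj : TotalSpace ℝ L → M))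
      [MemTrivializationAtlas e] [MemTrivializationAtlas e'] (hx : x ∈ e.baseSet)
      (hx' : φ x ∈ e'.baseSet) :
      (e' ⟨φ x, A x v⟩).2 = (e ⟨x, v⟩).2 * (e' ⟨φ x, A x (e.symm x 1)⟩).2 := by
    nth_rewrite 1 [e.eq_smul_symm_one hx v]
    rw [map_smul, e'.snd_smul_of_mem hx']
  have hcoef0 {x : M} (e e' : Trivialization ℝ (TotalSpace.proj : TotalSpace ℝ L → M))
      [MemTrivializationAtlas e] [MemTrivializationAtlas e'] (hx : x ∈ e.baseSet)
      (hx' : φ x ∈ e'.baseSet) : (e' ⟨φ x, A x (e.symm x 1)⟩).2 ≠ 0 :=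
    e'.snd_ne_zero_of_mem hx'
      ((map_ne_zero_iff _ (hA x)).mpr (e.symm_ne_zero_of_mem hx one_ne_zero))
  have hsurj (x : M) : Function.Surjective (A x) := by
    intro w
    have hx := mem_baseSet_trivializationAt ℝ L x
    have hx' := mem_baseSet_trivializationAt ℝ L (φ x)
    set e := trivializationAt ℝ L x
    set e' := trivializationAt ℝ L (φ x)
    have h0 := hcoef0 e e' hx hx'
    refine ⟨((e' ⟨φ x, w⟩).2 / (e' ⟨φ x, A x (e.symm x 1)⟩).2) • e.symm x 1, ?_⟩
    rw [map_smul, e'.eq_smul_symm_one hx' (A x (e.symm x 1)), smul_smul,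
      ← e'.eq_smul_symm_one hx' (A x (e.symm x 1)), div_mul_cancel₀ _ h0,
      ← e'.eq_smul_symm_one hx' w]
  have hbij : Function.Bijective (totalMap φ A) := by
    constructor
    · rintro ⟨x, v⟩ ⟨y, w⟩ h
      obtain rfl : x = y := φ.injective (congrArg TotalSpace.proj h)
      exact congrArg _ (hA x (eq_of_heq (TotalSpace.mk.inj h).2))
    · rintro ⟨y, w⟩
      obtain ⟨x, rfl⟩ := φ.surjective y
      obtain ⟨v, rfl⟩ := hsurj x w
      exact ⟨⟨x, v⟩, rfl⟩
  let Ψ := Equiv.ofBijective _ hbij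
  have hΨ (w : TotalSpace ℝ L) : φ (Ψ.symm w).1 = w.1 :=
    congrArg TotalSpace.proj (Ψ.apply_symm_apply w)
  have hΨ' (w : TotalSpace ℝ L) : (Ψ.symm w).1 = φ.symm w.1 := by
    rw [← hΨ w, φ.symm_apply_apply]
  refine ⟨⟨Ψ, hs, fun w => ?_⟩, fun x => ⟨A x, fun v => rfl⟩⟩
  have hx : φ.symm w.1 ∈ (trivializationAt ℝ L (φ.symm w.1)).baseSet :=
    mem_baseSet_trivializationAt ℝ L (φ.symm w.1)
  have hx' := mem_baseSet_trivializationAt ℝ L w.1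
  set e := trivializationAt ℝ L (φ.symm w.1)
  set e' := trivializationAt ℝ L w.1
  have hbase : ContMDiffAt (I.prod 𝓘(ℝ, ℝ)) I ∞ (fun u : TotalSpace ℝ L => φ.symm u.1) w :=
    φ.symm.contMDiff.contMDiffAt.comp w (contMDiffAt_proj L)
  change ContMDiffAt _ _ _ Ψ.symm w
  rw [e.contMDiffAt_iff (by rw [e.mem_source, hΨ']; exact hx)]
  refine ⟨by simpa only [hΨ'] using hbase, ?_⟩
  have hframe : ContMDiffAt (I.prod 𝓘(ℝ, ℝ)) (I.prod 𝓘(ℝ, ℝ)) ∞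
      (fun u : TotalSpace ℝ L => (⟨φ.symm u.1, e.symm (φ.symm u.1) 1⟩ : TotalSpace ℝ L)) w := by
    rw [e.contMDiffAt_iff (e.mem_source.mpr hx)]
    refine ⟨hbase, (contMDiffAt_const (c := (1 : ℝ))).congr_of_eventuallyEq ?_⟩
    filter_upwards [hbase.continuousAt.preimage_mem_nhds (e.open_baseSet.mem_nhds hx)] with u hu
    rw [e.apply_mk_symm hu]
  have hc : ContMDiffAt (I.prod 𝓘(ℝ, ℝ)) 𝓘(ℝ, ℝ) ∞ (fun u : TotalSpace ℝ L =>
      (e' (totalMap φ A ⟨φ.symm u.1, e.symm (φ.symm u.1) 1⟩)).2) w := by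
    have hmem : (totalMap φ A ⟨φ.symm w.1, e.symm (φ.symm w.1) 1⟩).1 ∈ e'.baseSet := by
      change φ (φ.symm w.1) ∈ _
      rwa [φ.apply_symm_apply]
    exact ContMDiffAt.comp w (g := fun u : TotalSpace ℝ L => (e' u).2)
      (contMDiffAt_trivialization_snd (I := I) e' hmem) (hs.contMDiffAt.comp w hframe)
  have hx'' : φ (φ.symm w.1) ∈ e'.baseSet := by rwa [φ.apply_symm_apply]
  refine ((contMDiffAt_trivialization_snd (I := I) e' hx').div₀ hc
    (hcoef0 e e' hx hx'')).congr_of_eventuallyEq ?_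
  filter_upwards [hbase.continuousAt.preimage_mem_nhds (e.open_baseSet.mem_nhds hx),
    (contMDiffAt_proj (IB := I) (n := ∞) L).continuousAt.preimage_mem_nhds
      (e'.open_baseSet.mem_nhds hx')] with u hu hu'
  obtain ⟨⟨y, v⟩, rfl⟩ := Ψ.surjective u
  have hy : φ.symm (φ y) ∈ e.baseSet := hu
  have hy' : φ y ∈ e'.baseSet := hu'
  rw [Ψ.symm_apply_apply]
  change (e ⟨y, v⟩).2 = (e' ⟨φ y, A y v⟩).2 /
    (e' (totalMap φ A ⟨φ.symm (φ y), e.symm (φ.symm (φ y)) 1⟩)).2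
  rw [φ.symm_apply_apply] at hy ⊢
  rw [hcoef e e' hy hy']
  exact (mul_div_cancel_right₀ _ (hcoef0 e e' hy hy')).symm

end Manifold

/-! ### Positive maps of fibres, and the lifting criterion -/

section Orientation

variable {M : Type*} [TopologicalSpace M] {L : M → Type*} [∀ x, AddCommGroup (L x)]
  [∀ x, Module ℝ (L x)] [TopologicalSpace (TotalSpace ℝ L)] [∀ x, TopologicalSpace (L x)]
  [FiberBundle ℝ L] [VectorBundle ℝ ℝ L]

open LineCover

/-- The linear maps `L x → L (φ x)` that, for every path `q` from `x₀` to `x`, send the half-line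
obtained from `z` by transport along `q` onto the one obtained from `w` by transport along
`φ ∘ q`. -/
def positiveMaps (φ : C(M, M)) {x₀ : M} (z : proj L ⁻¹' {x₀}) (w : proj L ⁻¹' {φ x₀}) (x : M) :
    Set (L x →ₗ[ℝ] L (φ x)) :=
  {A | ∀ (q : Path.Homotopic.Quotient x₀ x) (v : L x) (hv : v ≠ 0),
    transport q z = fiberMk v hv → ∃ h : A v ≠ 0, transport (q.map φ) w = fiberMk (A v) h}

theorem convex_positiveMaps (φ : C(M, M)) {x₀ : M} (z : proj L ⁻¹' {x₀})
    (w : proj L ⁻¹' {φ x₀}) (x : M) : Convex ℝ (positiveMaps φ z w x) := by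
  intro A hA B hB a b ha hb hab q v hv hq
  obtain ⟨hAv, hA'⟩ := hA q v hv hq
  obtain ⟨hBv, hB'⟩ := hB q v hv hq
  obtain ⟨c, hc, hcv⟩ := fiberMk_eq_iff.mp (hA'.symm.trans hB')
  have hpos : 0 < a + b * c := by
    rcases ha.eq_or_lt with rfl | ha'
    · have : b = 1 := by linarith
      rw [this]
      linarith
    · have := mul_nonneg hb hc.le
      linarith
  have heq : (a • A + b • B) v = (a + b * c) • A v := by
    rw [LinearMap.add_apply, LinearMap.smul_apply, LinearMap.smul_apply, hcv, smul_smul, add_smul]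
  refine ⟨by rw [heq]; exact smul_ne_zero hpos.ne' hAv, ?_⟩
  rw [hA', fiberMk_eq_iff]
  exact ⟨_, hpos, heq⟩

theorem injective_of_mem_positiveMaps [PathConnectedSpace M] {φ : C(M, M)} {x₀ : M}
    {z : proj L ⁻¹' {x₀}} {w : proj L ⁻¹' {φ x₀}} {x : M} {A : L x →ₗ[ℝ] L (φ x)}
    (hA : A ∈ positiveMaps φ z w x) : Function.Injective A := by
  rw [injective_iff_map_eq_zero]
  intro v hAv
  by_contra hv
  let q : Path.Homotopic.Quotient x₀ x := .mk (PathConnectedSpace.somePath x₀ x)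
  rcases eq_or_eq_fiberNeg (fiberMk v hv) (transport q z) with h | h
  · exact (hA q v hv h).1 hAv
  · exact (hA q (-v) (neg_ne_zero.mpr hv) h).1 (by rw [map_neg, hAv, neg_zero])

/-- If the loops fixing the half-line `z` are mapped to loops fixing `w` and vice versa, then it is
enough to test the positivity of a linear map on a single path. -/
theorem mem_positiveMaps_of_path {φ : C(M, M)} {x₀ : M} {z : proj L ⁻¹' {x₀}}
    {w : proj L ⁻¹' {φ x₀}}
    (hloop : ∀ g : Path.Homotopic.Quotient x₀ x₀,
      transport g z = z ↔ transport (g.map φ) w = w)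
    {x : M} {A : L x →ₗ[ℝ] L (φ x)} (q : Path.Homotopic.Quotient x₀ x) {v : L x} (hv : v ≠ 0)
    (hAv : A v ≠ 0) (hq : transport q z = fiberMk v hv)
    (hq' : transport (q.map φ) w = fiberMk (A v) hAv) : A ∈ positiveMaps φ z w x := by
  -- Two paths transport `z` to the same half-line exactly when their images do so with `w`.
  have hiff (r : Path.Homotopic.Quotient x₀ x) :
      transport r z = transport q z ↔ transport (r.map φ) w = transport (q.map φ) w := by
    have hm : (r.trans q.symm).map φ = (r.map φ).trans (q.map φ).symm := by
      obtain ⟨r⟩ := r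
      obtain ⟨q⟩ := q
      exact congrArg Path.Homotopic.Quotient.mk (Path.map_trans r q.symm φ.continuous)
    have h := hloop (r.trans q.symm)
    rw [hm, transport_trans, transport_trans] at h
    rw [← (transport_injective q.symm).eq_iff, transport_symm_transport, h,
      ← (transport_injective (q.map φ).symm).eq_iff, transport_symm_transport]
  intro r u hu hr
  have hmain (u : L x) (hu : u ≠ 0) (c : ℝ) (hc : 0 < c) (huv : u = c • v) :
      ∃ h : A u ≠ 0, (fiberMk (A v) hAv : proj L ⁻¹' {φ x}) = fiberMk (A u) h := by
    have hAu : A u = c • A v := by rw [huv, map_smul]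
    exact ⟨by rw [hAu]; exact smul_ne_zero hc.ne' hAv, fiberMk_eq_iff.mpr ⟨c, hc, hAu⟩⟩
  by_cases h : transport r z = transport q z
  · obtain ⟨c, hc, huv⟩ := fiberMk_eq_iff.mp ((hq.symm.trans h.symm).trans hr)
    rw [(hiff r).mp h, hq']
    exact hmain u hu c hc huv
  -- Otherwise `r` gives the opposite half-lines on both sides, and `-u` is used in place of `u`.
  · have h' := fun h' => h ((hiff r).mpr h')
    rw [← Ne, ← fiberNeg_eq_iff_ne] at h
    have h'' := fiberNeg_eq_iff_ne.mpr h'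
    have hu' : fiberNeg (fiberMk u hu) = (fiberMk v hv : proj L ⁻¹' {x}) := by
      rw [← hr, ← h, fiberNeg_fiberNeg, hq]
    rw [fiberNeg_fiberMk] at hu'
    obtain ⟨c, hc, huv⟩ := fiberMk_eq_iff.mp hu'.symm
    obtain ⟨hAu, hAu'⟩ := hmain (-u) (neg_ne_zero.mpr hu) c hc huv
    have hAu0 : A u ≠ 0 := by
      intro h0
      exact hAu (by rw [map_neg, h0, neg_zero])
    refine ⟨hAu0, ?_⟩
    rw [← h'', hq', hAu', fiberNeg_fiberMk]
    simp only [map_neg, neg_neg]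

end Orientation

section Manifold

variable {E : Type*} [NormedAddCommGroup E] [NormedSpace ℝ E] {H : Type*} [TopologicalSpace H]
  {I : ModelWithCorners ℝ E H} {M : Type*} [TopologicalSpace M] [ChartedSpace H M]
  {L : M → Type*} [∀ x, AddCommGroup (L x)] [∀ x, Module ℝ (L x)]
  [TopologicalSpace (TotalSpace ℝ L)] [∀ x, TopologicalSpace (L x)] [FiberBundle ℝ L]
  [VectorBundle ℝ ℝ L] [ContMDiffVectorBundle ∞ ℝ L I]

open LineCover

/-- Near each point there is a smooth family of positive maps: in trivializations of `L` near `x₁`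
and `φ x₁`, multiplication by a constant of the right sign. -/
theorem exists_local_positiveMaps [LocallyPathConnectedSpace M] [PathConnectedSpace M]
    {φ : C(M, M)} (hφ : ContMDiff I I ∞ φ) {x₀ : M} {z : proj L ⁻¹' {x₀}}
    {w : proj L ⁻¹' {φ x₀}}
    (hloop : ∀ g : Path.Homotopic.Quotient x₀ x₀,
      transport g z = z ↔ transport (g.map φ) w = w) (x₁ : M) :
    ∃ U ∈ nhds x₁, ∃ A : ∀ x, L x →ₗ[ℝ] L (φ x), ∀ x ∈ U, A x ∈ positiveMaps φ z w x ∧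
      ∀ v : L x, ContMDiffAt (I.prod 𝓘(ℝ, ℝ)) (I.prod 𝓘(ℝ, ℝ)) ∞ (totalMap φ A) ⟨x, v⟩ := by
  have hx₁ := mem_baseSet_trivializationAt ℝ L x₁
  have hx₁' := mem_baseSet_trivializationAt ℝ L (φ x₁)
  set e := trivializationAt ℝ L x₁
  set e' := trivializationAt ℝ L (φ x₁)
  obtain ⟨U, ⟨hU, hUpath⟩, hUe⟩ := (LocallyPathConnectedSpace.path_connected_basis x₁).mem_iff.mp
    (Filter.inter_mem (e.open_baseSet.mem_nhds hx₁)
      (φ.continuous.continuousAt.preimage_mem_nhds (e'.open_baseSet.mem_nhds hx₁')))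
  let q : Path.Homotopic.Quotient x₀ x₁ := .mk (PathConnectedSpace.somePath x₀ x₁)
  obtain ⟨v₁, hv₁, hq⟩ := exists_eq_fiberMk (transport q z)
  obtain ⟨w₁, hw₁, hq'⟩ := exists_eq_fiberMk (transport (q.map φ) w)
  set a := (e ⟨x₁, v₁⟩).2 with ha_def
  set b := (e' ⟨φ x₁, w₁⟩).2 with hb_def
  have ha : a ≠ 0 := e.snd_ne_zero_of_mem hx₁ hv₁
  have hb : b ≠ 0 := e'.snd_ne_zero_of_mem hx₁' hw₁
  have hv₁' : (fiberMk v₁ hv₁ : proj L ⁻¹' {x₁}) =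
      fiberMk (e.symm x₁ a) (e.symm_ne_zero_of_mem hx₁ ha) := by
    simp only [ha_def, e.symm_apply_apply_mk hx₁]
  have hw₁' : (fiberMk w₁ hw₁ : proj L ⁻¹' {φ x₁}) =
      fiberMk (e'.symm (φ x₁) b) (e'.symm_ne_zero_of_mem hx₁' hb) := by
    simp only [hb_def, e'.symm_apply_apply_mk hx₁']
  -- The constant `b / a` makes the map carry `v₁` to `w₁`.
  let A (x : M) : L x →ₗ[ℝ] L (φ x) :=
    e'.symmₗ ℝ (φ x) ∘ₗ ((b / a) • e.linearMapAt ℝ x)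
  have hAdef {x : M} (hx : x ∈ U) (v : L x) :
      A x v = e'.symm (φ x) (b / a * (e ⟨x, v⟩).2) := by
    have h1 := e.coe_linearMapAt_of_mem (R := ℝ) (hUe hx).1
    have h2 := e'.coe_symmₗ (R := ℝ) (hUe hx).2
    simp only [A, LinearMap.comp_apply, LinearMap.smul_apply, h1, h2, smul_eq_mul]
  refine ⟨interior U, interior_mem_nhds.mpr hU, A, fun x hxU => ⟨?_, fun v => ?_⟩⟩
  · have hx := interior_subset hxU
    obtain ⟨δ, hδ⟩ := hUpath.joinedIn x₁ (mem_of_mem_nhds hU) x hx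
    have hxe : x ∈ e.baseSet := (hUe hx).1
    have hxe' : φ x ∈ e'.baseSet := (hUe hx).2
    have hA : A x (e.symm x a) = e'.symm (φ x) b := by
      rw [hAdef hx, e.apply_mk_symm hxe, div_mul_cancel₀ _ ha]
    refine mem_positiveMaps_of_path hloop (q.trans (.mk δ)) (e.symm_ne_zero_of_mem hxe ha)
      (by rw [hA]; exact e'.symm_ne_zero_of_mem hxe' hb) ?_ ?_
    · rw [transport_trans, hq, hv₁', transport_mk_symm e δ (fun t => (hUe (hδ t)).1) hx₁ hxe ha]
    · have hm : (q.trans (.mk δ)).map φ = (q.map φ).trans (.mk (δ.map φ.continuous)) :=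
        congrArg Path.Homotopic.Quotient.mk (Path.map_trans _ δ φ.continuous)
      rw [hm, transport_trans, hq', hw₁', transport_mk_symm e' (δ.map φ.continuous)
        (fun t => (hUe (hδ t)).2) hx₁' hxe' hb]
      simp only [hA]
  · have hx := interior_subset hxU
    rw [contMDiffAt_totalMap_iff hφ e' (v := ⟨x, v⟩) (hUe hx).2]
    refine ((contMDiffAt_const (c := b / a)).mul
      (contMDiffAt_trivialization_snd (I := I) e (v := ⟨x, v⟩) (hUe hx).1)).congr_of_eventuallyEq ?_
    filter_upwards [(FiberBundle.continuous_proj ℝ L).continuousAt.preimage_mem_nhds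
      (isOpen_interior.mem_nhds hxU)] with u hu
    have hu' : u.1 ∈ U := interior_subset hu
    change (e' ⟨φ u.1, A u.1 u.2⟩).2 = _
    rw [hAdef hu', e'.apply_mk_symm (hUe hu').2]
    rfl

/-- A diffeomorphism lifts to an automorphism of the line bundle `L` if and only if it preserves
the set of loops along which the half-lines of `L` come back to themselves. -/
theorem liftsToAut_iff_transport [FiniteDimensional ℝ E] [IsManifold I ∞ M] [T2Space M]
    [SigmaCompactSpace M] [LocallyPathConnectedSpace M] [PathConnectedSpace M]
    (φ : Diffeomorph I I M M ∞) {x₀ : M} (z : proj L ⁻¹' {x₀})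
    (w : proj L ⁻¹' {φ x₀}) :
    LiftsToAut I L φ ↔ ∀ g : Path.Homotopic.Quotient x₀ x₀,
      transport g z = z ↔ transport (g.map (φ : C(M, M))) w = w := by
  constructor
  · rintro ⟨Φ, hΦ⟩ g
    choose A hA using hΦ
    have htotal : totalMap φ A = Φ := funext fun v => (hA v.1 v.2).symm
    refine transport_map_eq_self_iff_of_totalMap (φ := (φ : C(M, M))) (A := A) (fun x => ?_) ?_ g z w
    · intro v v' h
      have h' : Φ ⟨x, v⟩ = Φ ⟨x, v'⟩ := by rw [hA, hA, h]
      exact eq_of_heq (TotalSpace.mk.inj (Φ.injective h')).2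
    · exact (congrArg Continuous htotal).mpr Φ.continuous
  · intro hloop
    obtain ⟨A, hA, hs⟩ := exists_contMDiff_totalMap_of_local (I := I) (φ := (φ : C(M, M)))
      φ.contMDiff (positiveMaps (φ : C(M, M)) z w) (convex_positiveMaps (φ : C(M, M)) z w)
      (exists_local_positiveMaps (φ := (φ : C(M, M))) φ.contMDiff hloop)
    exact liftsToAut_of_contMDiff_totalMap (φ := φ) (A := A)
      (fun x => injective_of_mem_positiveMaps (hA x)) hs

end Manifold

/-! ### Reformulation with fundamental groups -/

theorem Subgroup.map_eq_self_iff_of_bijective {G : Type*} [Group G] {f : G →* G}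
    (hf : Function.Bijective f) (K : Subgroup G) :
    K.map f = K ↔ ∀ g, g ∈ K ↔ f g ∈ K := by
  constructor
  · intro h g
    nth_rewrite 2 [← h]
    exact (Subgroup.mem_map_iff_mem hf.1).symm
  · intro h
    ext g
    obtain ⟨g, rfl⟩ := hf.2 g
    rw [Subgroup.mem_map_iff_mem hf.1, h]
theorem mainTheorem9 {E : Type*} [NormedAddCommGroup E] [NormedSpace ℝ E] [FiniteDimensional ℝ E]
    {H : Type*} [TopologicalSpace H] (I : ModelWithCorners ℝ E H)
    {M : Type*} [TopologicalSpace M] [ChartedSpace H M] [IsManifold I ∞ M]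
    [BoundarylessManifold I M] [T2Space M] [SecondCountableTopology M] [ConnectedSpace M]
    (L : M → Type*) [∀ x, AddCommGroup (L x)] [∀ x, Module ℝ (L x)]
    [TopologicalSpace (TotalSpace ℝ L)] [∀ x, TopologicalSpace (L x)] [FiberBundle ℝ L]
    [VectorBundle ℝ ℝ L] [ContMDiffVectorBundle ∞ ℝ L I] :
    (∀ (φ : Diffeomorph I I M M ∞) (z : LineCover L)
        (γ : Path (φ (LineCover.proj L z)) (LineCover.proj L z)),
      LiftsToAut I L φ ↔
        (LineCover.piOneSubgroup L z).map (piOneMap (φ : C(M, M)) γ) =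
          LineCover.piOneSubgroup L z) ∧
    ∀ x : M, (∃! K : Subgroup (FundamentalGroup M x), K.index = 2) →
      ∀ φ : Diffeomorph I I M M ∞, LiftsToAut I L φ := by
  have := BoundarylessManifold.locallyPathConnectedSpace I M
  have : PathConnectedSpace M := pathConnectedSpace_iff_connectedSpace.mpr inferInstance
  have : LocallyCompactSpace M := Manifold.locallyCompact_of_finiteDimensional I
  have hbij (φ : Diffeomorph I I M M ∞) (x : M) (γ : Path (φ x) x) :
      Function.Bijective (piOneMap (φ : C(M, M)) γ) := piOneMap_bijective φ.toHomeomorph γ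
  have hiff (φ : Diffeomorph I I M M ∞) (z : LineCover L)
      (γ : Path (φ (LineCover.proj L z)) (LineCover.proj L z)) :
      LiftsToAut I L φ ↔
        (LineCover.piOneSubgroup L z).map (piOneMap (φ : C(M, M)) γ) =
          LineCover.piOneSubgroup L z := by
    obtain ⟨w, hw⟩ := LineCover.surjective_proj (L := L) (φ (LineCover.proj L z))
    rw [Subgroup.map_eq_self_iff_of_bijective (hbij φ _ γ),
      liftsToAut_iff_transport φ ⟨z, rfl⟩ ⟨w, hw⟩]
    refine forall_congr' fun g => ?_
    rw [LineCover.mem_piOneSubgroup_iff]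
    exact iff_congr Iff.rfl
      (LineCover.piOneMap_mem_piOneSubgroup_iff (φ : C(M, M)) z γ g ⟨w, hw⟩).symm
  refine ⟨hiff, ?_⟩
  rintro x ⟨K, -, hK⟩ φ
  obtain ⟨z, rfl⟩ := LineCover.surjective_proj (L := L) x
  have γ := PathConnectedSpace.somePath (φ (LineCover.proj L z)) (LineCover.proj L z)
  rw [hiff φ z γ]
  rcases LineCover.piOneSubgroup_eq_top_or_index_eq_two z with h | h
  · rw [h, Subgroup.map_top_of_surjective _ (hbij φ _ γ).2]
  · rw [hK _ h]
    refine hK _ ?_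
    change (Subgroup.map (piOneMap (φ : C(M, M)) γ) K).index = 2
    rw [Subgroup.index_map_of_bijective (hbij φ _ γ), ← hK _ h, h]
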